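/- For $d\in\mathbb{N}$ consider the subgroups \[ H_d=\{(X,\,Y+aX^d)\mid a\in\mathbb{C}\},\qquad K_d=\{(X+aY^d,\,Y)\mid a\in\mathbb{C}\} \] of the group of polynomial automorphisms of the affine plane $\mathbb{C}^2$, and let $\langle H_2,K_1\rangle$ be the subgroup generated by $H_2$ and $K_1$, acting on $\mathbb{C}^2$ by evaluation. Then $\langle H_2,K_1\rangle$ has exactly one Zariski-open orbit in $\mathbb{C}^2$, and it acts infinitely transitively on this open orbit $O$: for every $m\in\mathbb{N}$ and any two $m$-tuples $(p_1,\dots,p_m)$ and $(q_1,\dots,q_m)$ of pairwise distinct points of $O$, there is $g\in\langle H_2,K_1\rangle$ with $g(p_i)=q_i$ for all $1\le i\le m$. -/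

import Mathlib

/-- A self-map of the affine plane `ℂ²` both of whose components are polynomials. -/
def IsPolynomialMap (f : (Fin 2 → ℂ) → (Fin 2 → ℂ)) : Prop :=
  ∃ F : Fin 2 → MvPolynomial (Fin 2) ℂ, ∀ p i, f p i = MvPolynomial.eval p (F i)

theorem IsPolynomialMap.comp {f g : (Fin 2 → ℂ) → (Fin 2 → ℂ)}
    (hf : IsPolynomialMap f) (hg : IsPolynomialMap g) : IsPolynomialMap (f ∘ g) := by
  obtain ⟨F, hF⟩ := hf
  obtain ⟨G, hG⟩ := hg
  refine ⟨fun i => MvPolynomial.bind₁ G (F i), fun p i => ?_⟩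
  have h : g p = fun j => MvPolynomial.eval p (G j) := funext (hG p)
  rw [Function.comp_apply, hF, h]
  exact (MvPolynomial.eval₂Hom_bind₁ _ _ _ _).symm

/-- The group of polynomial automorphisms of the affine plane `ℂ²` (bijections that are polynomial
in both directions), with composition of maps as the group law. -/
def PlaneAut : Subgroup (Equiv.Perm (Fin 2 → ℂ)) where
  carrier := {σ | IsPolynomialMap σ ∧ IsPolynomialMap σ.symm}
  one_mem' :=
    ⟨⟨MvPolynomial.X, fun p i => by simp⟩, ⟨MvPolynomial.X, fun p i => by
      simp [Equiv.Perm.one_def]⟩⟩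
  mul_mem' := fun {_ _} hσ hτ => ⟨hσ.1.comp hτ.1, hτ.2.comp hσ.2⟩
  inv_mem' := fun {_} hσ => ⟨hσ.2, hσ.1⟩

open MvPolynomial in
/-- The automorphism `(X, Y + a X ^ d)`. -/
noncomputable def shearH (d : ℕ) (a : ℂ) : PlaneAut :=
  ⟨{ toFun := fun p => ![p 0, p 1 + a * p 0 ^ d]
     invFun := fun p => ![p 0, p 1 - a * p 0 ^ d]
     left_inv := fun p => by ext i; fin_cases i <;> simp
     right_inv := fun p => by ext i; fin_cases i <;> simp },
    ⟨![X 0, X 1 + C a * X 0 ^ d], fun p i => by fin_cases i <;> simp⟩,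
    ⟨![X 0, X 1 - C a * X 0 ^ d], fun p i => by fin_cases i <;> simp⟩⟩

open MvPolynomial in
/-- The automorphism `(X + a Y ^ d, Y)`. -/
noncomputable def shearK (d : ℕ) (a : ℂ) : PlaneAut :=
  ⟨{ toFun := fun p => ![p 0 + a * p 1 ^ d, p 1]
     invFun := fun p => ![p 0 - a * p 1 ^ d, p 1]
     left_inv := fun p => by ext i; fin_cases i <;> simp
     right_inv := fun p => by ext i; fin_cases i <;> simp },
    ⟨![X 0 + C a * X 1 ^ d, X 1], fun p i => by fin_cases i <;> simp⟩,
    ⟨![X 0 - C a * X 1 ^ d, X 1], fun p i => by fin_cases i <;> simp⟩⟩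

/-- The root subgroup `H_d = {(X, Y + a X ^ d) | a ∈ ℂ}`. -/
noncomputable def rootH (d : ℕ) : Subgroup PlaneAut where
  carrier := {σ | ∃ a : ℂ, σ = shearH d a}
  one_mem' := ⟨0, by
    ext p i; fin_cases i <;> simp [shearH]⟩
  mul_mem' := by
    rintro _ _ ⟨a, rfl⟩ ⟨b, rfl⟩
    refine ⟨b + a, ?_⟩
    ext p i; fin_cases i <;> simp [shearH, add_mul, add_assoc]
  inv_mem' := by
    rintro _ ⟨a, rfl⟩
    refine ⟨-a, inv_eq_of_mul_eq_one_right ?_⟩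
    ext p i; fin_cases i <;> simp [shearH]

/-- The root subgroup `K_d = {(X + a Y ^ d, Y) | a ∈ ℂ}`. -/
noncomputable def rootK (d : ℕ) : Subgroup PlaneAut where
  carrier := {σ | ∃ a : ℂ, σ = shearK d a}
  one_mem' := ⟨0, by
    ext p i; fin_cases i <;> simp [shearK]⟩
  mul_mem' := by
    rintro _ _ ⟨a, rfl⟩ ⟨b, rfl⟩
    refine ⟨b + a, ?_⟩
    ext p i; fin_cases i <;> simp [shearK, add_mul, add_assoc]
  inv_mem' := by
    rintro _ ⟨a, rfl⟩
    refine ⟨-a, inv_eq_of_mul_eq_one_right ?_⟩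
    ext p i; fin_cases i <;> simp [shearK]

/-- The action on `ℂ²` of a group of polynomial automorphisms is evaluation. -/
theorem planeAut_smul_def (Γ : Subgroup PlaneAut) (g : Γ) (p : Fin 2 → ℂ) :
    g • p = (g : PlaneAut).1 p := rfl

/-- A subset of `ℂ²` is Zariski open if it is the complement of the zero locus of an ideal. -/
def IsZariskiOpen (U : Set (Fin 2 → ℂ)) : Prop :=
  ∃ I : Ideal (MvPolynomial (Fin 2) ℂ), U = (MvPolynomial.zeroLocus ℂ I)ᶜ

/-- A group acts infinitely transitively on `α` if for every `m` it acts transitively on the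
`m`-tuples of pairwise distinct points of `α`. -/
def IsInfinitelyTransitive (G α : Type*) [Group G] [MulAction G α] : Prop :=
  ∀ m : ℕ, MulAction.IsMultiplyPretransitive G α m

/-! The shears fix the origin and have Jacobian determinant 1. If the Hamiltonian field of `h` is
the velocity of a family in the group, conjugating the family by `g` realises the field of `h ∘ g`.
The shears in `H_2` realise `X ^ 3`, and the span of what follows by conjugation contains every
monomial of degree at least 3 (`monomial_mem_of_shear_stable`).

Such Hamiltonians prescribe arbitrary tangent vectors at finitely many distinct nonzero points
(`map_hamiltonianField_eq_top`). Composing finitely many families then gives a map into the orbit of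
the tuple with surjective derivative, so that orbit is a neighbourhood of the tuple
(`eventually_exists_smul_eq`). Any two such tuples are joined by a connected set of such tuples,
which gives transitivity (`exists_smul_eq_of_injective`). The orbits are thus the origin and its
complement. -/

/-! ### Hamiltonian fields and substitutions -/

open MvPolynomial in
/-- The Hamiltonian vector field `(∂h/∂Y, -∂h/∂X)` of a polynomial `h`, evaluated at `p`. -/
noncomputable def hamiltonianField (p : Fin 2 → ℂ) :
    MvPolynomial (Fin 2) ℂ →ₗ[ℂ] (Fin 2 → ℂ) :=
  LinearMap.pi ![(aeval p).toLinearMap ∘ₗ (pderiv (R := ℂ) (1 : Fin 2)).toLinearMap,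
    -((aeval p).toLinearMap ∘ₗ (pderiv (R := ℂ) (0 : Fin 2)).toLinearMap)]

open MvPolynomial in
theorem hamiltonianField_apply (p : Fin 2 → ℂ) (h : MvPolynomial (Fin 2) ℂ) :
    hamiltonianField p h = ![eval p (pderiv 1 h), -eval p (pderiv 0 h)] := by
  ext i
  fin_cases i <;> simp [hamiltonianField, aeval_eq_eval]

open MvPolynomial in
theorem pderiv_bind₁ {R σ τ : Type*} [CommRing R] [Fintype σ] (i : τ)
    (f : σ → MvPolynomial τ R) (h : MvPolynomial σ R) :
    pderiv i (bind₁ f h) = ∑ j, bind₁ f (pderiv j h) * pderiv i (f j) := by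
  classical
  induction h using MvPolynomial.induction_on with
  | C a => simp
  | add p q hp hq => simp [hp, hq, add_mul, Finset.sum_add_distrib]
  | mul_X p k hp =>
    simp only [map_mul, bind₁_X_right, Derivation.leibniz, smul_eq_mul, hp, pderiv_X, map_add,
      add_mul, Finset.sum_add_distrib, Finset.mul_sum]
    congr 1
    · rw [Finset.sum_eq_single k]
      · simp [mul_comm]
      · intro b _ hb
        simp [hb.symm]
      · simp
    · exact Finset.sum_congr rfl fun j _ => by ring

open MvPolynomial in
theorem eval_bind₁ {R σ τ : Type*} [CommRing R] (p : τ → R)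
    (f : σ → MvPolynomial τ R) (h : MvPolynomial σ R) :
    eval p (bind₁ f h) = eval (fun j => eval p (f j)) h :=
  eval₂Hom_bind₁ _ _ _ _

/-! ### Polynomial spaces stable under the two shears -/

/-- If a polynomial in `t` with vector coefficients takes values in a subspace for all scalars `t`,
then its coefficients lie in that subspace. -/
theorem Submodule.coeff_mem_of_forall_sum_pow_smul_mem {K M : Type*} [Field K] [Infinite K]
    [AddCommGroup M] [Module K M] (S : Submodule K M) (n : ℕ) (c : ℕ → M)
    (h : ∀ t : K, ∑ k ∈ Finset.range n, t ^ k • c k ∈ S) {k : ℕ} (hk : k < n) : c k ∈ S := by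
  rw [← Submodule.Quotient.mk_eq_zero, ← Module.forall_dual_apply_eq_zero_iff K]
  intro f
  have hP : (∑ j ∈ Finset.range n,
      Polynomial.C (f (Submodule.Quotient.mk (c j))) * Polynomial.X ^ j) = 0 := by
    refine Polynomial.funext fun t => ?_
    have := congrArg f ((Submodule.Quotient.mk_eq_zero S).2 (h t))
    rw [← Submodule.mkQ_apply, map_sum, map_sum, map_zero] at this
    simp only [Submodule.mkQ_apply, map_smul, smul_eq_mul] at this
    simp only [Polynomial.eval_finsetSum, Polynomial.eval_mul, Polynomial.eval_C,
      Polynomial.eval_pow, Polynomial.eval_X, Polynomial.eval_zero]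
    exact (Finset.sum_congr rfl fun j _ => mul_comm _ _).trans this
  simpa [Polynomial.finsetSum_coeff, Polynomial.coeff_C_mul, Polynomial.coeff_X_pow, hk]
    using congrArg (Polynomial.coeff · k) hP

open MvPolynomial in
/-- A space of polynomials that contains `X ^ 3` and is stable under the substitutions
`X ↦ X + tY` and `Y ↦ Y + tX ^ 2` contains all monomials of degree at least `3`. -/
theorem monomial_mem_of_shear_stable (S : Submodule ℂ (MvPolynomial (Fin 2) ℂ))
    (h3 : X 0 ^ 3 ∈ S)
    (hK : ∀ h ∈ S, ∀ t : ℂ, bind₁ ![X 0 + C t * X 1, X 1] h ∈ S)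
    (hH : ∀ h ∈ S, ∀ t : ℂ, bind₁ ![X 0, X 1 + C t * X 0 ^ 2] h ∈ S) (a b : ℕ)
    (hab : 3 ≤ a + b) : X 0 ^ a * X 1 ^ b ∈ S := by
  have stepK : ∀ a b : ℕ, X 0 ^ (a + 1) * X 1 ^ b ∈ S → X 0 ^ a * X 1 ^ (b + 1) ∈ S := by
    intro a b hS
    -- The coefficient of `t` is `(a + 1) X ^ a Y ^ (b + 1)`, with a nonzero scalar in
    -- characteristic zero.
    have key := S.coeff_mem_of_forall_sum_pow_smul_mem (a + 1 + 1)
      (fun k => ((a + 1).choose k : ℂ) • (X 0 ^ (a + 1 - k) * X 1 ^ (b + k))) (fun t => by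
        convert hK _ hS t using 1
        simp only [map_mul, map_pow, bind₁_X_right, Matrix.cons_val_zero, Matrix.cons_val_one]
        rw [add_comm (X 0) (C t * X 1), add_pow, Finset.sum_mul]
        refine Finset.sum_congr rfl fun k _ => ?_
        simp only [smul_eq_C_mul, map_pow, map_natCast]
        ring) (k := 1) (by omega)
    rw [S.smul_mem_iff (by rw [Nat.choose_one_right]; exact Nat.cast_ne_zero.2 (Nat.succ_ne_zero _))] at key
    exact key
  have stepH : ∀ a b : ℕ, X 0 ^ a * X 1 ^ (b + 1) ∈ S → X 0 ^ (a + 2) * X 1 ^ b ∈ S := by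
    intro a b hS
    have key := S.coeff_mem_of_forall_sum_pow_smul_mem (b + 1 + 1)
      (fun k => ((b + 1).choose k : ℂ) • (X 0 ^ (a + 2 * k) * X 1 ^ (b + 1 - k))) (fun t => by
        convert hH _ hS t using 1
        simp only [map_mul, map_pow, bind₁_X_right, Matrix.cons_val_zero, Matrix.cons_val_one]
        rw [add_comm (X 1) (C t * X 0 ^ 2), add_pow, Finset.mul_sum]
        refine Finset.sum_congr rfl fun k _ => ?_
        simp only [smul_eq_C_mul, map_pow, map_natCast]
        ring) (k := 1) (by omega)
    rw [S.smul_mem_iff (by rw [Nat.choose_one_right]; exact Nat.cast_ne_zero.2 (Nat.succ_ne_zero _))] at key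
    exact key
  have down : ∀ a b k : ℕ, X 0 ^ (a + k) * X 1 ^ b ∈ S → X 0 ^ a * X 1 ^ (b + k) ∈ S := by
    intro a b k
    induction k generalizing b with
    | zero => exact id
    | succ k ih =>
      intro h
      have := ih (b + 1) (stepK (a + k) b h)
      rwa [show b + (k + 1) = b + 1 + k by ring]
  have all : ∀ n : ℕ, ∀ a b : ℕ, a + b = n + 3 → X 0 ^ a * X 1 ^ b ∈ S := by
    intro n
    induction n with
    | zero =>
      intro a b hab
      have := down a 0 b (by simpa [hab] using h3)
      rwa [zero_add] at this
    | succ n ih =>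
      intro a b hab
      -- `stepH` raises the degree by one but leaves a factor `X ^ 2`; the exponents 0 and 1 of `X`
      -- are then reached by `down`.
      have top : ∀ a b : ℕ, a + 2 + b = n + 1 + 3 → X 0 ^ (a + 2) * X 1 ^ b ∈ S :=
        fun a b hab => stepH a b (ih a (b + 1) (by omega))
      match a, hab with
      | 0, hab =>
        obtain rfl : b = n + 2 + 2 := by omega
        exact down 0 (n + 2) 2 (top 0 (n + 2) (by omega))
      | 1, hab =>
        obtain rfl : b = n + 2 + 1 := by omega
        exact down 1 (n + 2) 1 (top 0 (n + 2) (by omega))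
      | a + 2, hab => exact top a b hab
  exact all (a + b - 3) a b (by omega)

open MvPolynomial in
theorem X_pow_three_mul_mem (S : Submodule ℂ (MvPolynomial (Fin 2) ℂ))
    (hS : ∀ a b : ℕ, 3 ≤ a + b → X 0 ^ a * X 1 ^ b ∈ S) (k : Fin 2) (q : MvPolynomial (Fin 2) ℂ) :
    X k ^ 3 * q ∈ S := by
  induction q using MvPolynomial.induction_on' with
  | monomial s c =>
    rw [monomial_eq, Finsupp.prod_fintype _ _ (by simp), Fin.prod_univ_two, mul_left_comm,
      ← smul_eq_C_mul]
    refine S.smul_mem c ?_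
    fin_cases k
    · convert hS (3 + s 0) (s 1) (by omega) using 1
      simp only [Fin.zero_eta]; ring
    · convert hS (s 0) (3 + s 1) (by omega) using 1
      simp only [Fin.mk_one]; ring
  | add p q hp hq => rw [mul_add]; exact S.add_mem hp hq

/-! ### Interpolation of tangent vectors -/

open MvPolynomial in
/-- Hamiltonian fields of polynomials of order at least `3` at the origin interpolate arbitrary
tangent vectors at finitely many distinct nonzero points. -/
theorem map_hamiltonianField_eq_top (S : Submodule ℂ (MvPolynomial (Fin 2) ℂ))
    (hS : ∀ (k : Fin 2) (q : MvPolynomial (Fin 2) ℂ), X k ^ 3 * q ∈ S) {ι : Type*} [Fintype ι]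
    (P : ι → Fin 2 → ℂ) (hinj : Function.Injective P) (h0 : ∀ i, P i ≠ 0) :
    S.map (LinearMap.pi fun i => hamiltonianField (P i)) = ⊤ := by
  classical
  have bump : ∀ i, ∃ e : MvPolynomial (Fin 2) ℂ, (∀ q, e * q ∈ S) ∧ eval (P i) e ≠ 0 ∧
      ∀ j ≠ i, ∃ l r, e = l ^ 2 * r ∧ eval (P j) l = 0 := by
    intro i
    obtain ⟨k, hk⟩ := Function.ne_iff.1 (h0 i)
    have sep : ∀ j, ∃ l : MvPolynomial (Fin 2) ℂ, eval (P j) l = 0 ∧ (j ≠ i → eval (P i) l ≠ 0) := by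
      intro j
      by_cases hj : j = i
      · exact ⟨0, by simp, fun h => absurd hj h⟩
      · obtain ⟨k, hk⟩ := Function.ne_iff.1 (hinj.ne (Ne.symm hj))
        exact ⟨X k - C (P j k), by simp, fun _ => by simpa [sub_eq_zero] using hk⟩
    choose l hl hl' using sep
    -- The cube keeps all multiples in `S`; the squares kill value and gradient at the other points.
    refine ⟨X k ^ 3 * ∏ j ∈ Finset.univ.erase i, l j ^ 2, fun q => ?_, ?_, fun j hj => ?_⟩
    · rw [mul_assoc]; exact hS _ _
    · simp only [map_mul, map_pow, eval_X, map_prod]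
      refine mul_ne_zero (pow_ne_zero _ hk) (Finset.prod_ne_zero_iff.2 fun j hj => ?_)
      exact pow_ne_zero _ (hl' j (Finset.ne_of_mem_erase hj))
    · refine ⟨l j, X k ^ 3 * ∏ j' ∈ (Finset.univ.erase i).erase j, l j' ^ 2, ?_, hl j⟩
      rw [← Finset.mul_prod_erase _ _ (Finset.mem_erase.2 ⟨hj, Finset.mem_univ j⟩)]
      ring
  choose e heS hei hej using bump
  refine eq_top_iff.2 fun w _ => ?_
  -- Since `q i` vanishes at `P i`, the field of `e i * q i` there is `e i (P i)` times that of `q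
  -- i`, namely `w i`.
  let q : ι → MvPolynomial (Fin 2) ℂ := fun i =>
    C (w i 0 / eval (P i) (e i)) * (X 1 - C (P i 1)) -
      C (w i 1 / eval (P i) (e i)) * (X 0 - C (P i 0))
  refine ⟨∑ i, e i * q i, S.sum_mem fun i _ => heS i _, ?_⟩
  ext1 j
  rw [LinearMap.pi_apply, map_sum, Finset.sum_eq_single j]
  · rw [hamiltonianField_apply]
    have := hei j
    ext i
    fin_cases i <;> simp [q, pderiv_X] <;> field_simp
  · intro i _ hij
    obtain ⟨l, r, h, hl⟩ := hej i j hij.symm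
    rw [h, hamiltonianField_apply]
    ext i
    fin_cases i <;> simp [hl]
  · simp

/-! ### Velocities of the group -/

/-- The group `⟨H_2, K_1⟩`. -/
noncomputable abbrev twoShearGroup : Subgroup PlaneAut := rootH 2 ⊔ rootK 1

theorem shearH_mem (a : ℂ) : shearH 2 a ∈ twoShearGroup :=
  Subgroup.mem_sup_left ⟨a, rfl⟩

theorem shearK_mem (a : ℂ) : shearK 1 a ∈ twoShearGroup :=
  Subgroup.mem_sup_right ⟨a, rfl⟩

/-- The Hamiltonian field of `h` is the velocity at `t = 0` of a family `φ t` of elements of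
`⟨H_2, K_1⟩` with `φ 0 = 1`. -/
def IsVelocity (h : MvPolynomial (Fin 2) ℂ) : Prop :=
  ∃ φ : ℂ → twoShearGroup, φ 0 = 1 ∧ ∀ p : Fin 2 → ℂ,
    HasStrictFDerivAt (fun z : ℂ × (Fin 2 → ℂ) => φ z.1 • z.2)
      ((ContinuousLinearMap.toSpanSingleton ℂ (hamiltonianField p h)).coprod
        (ContinuousLinearMap.id ℂ (Fin 2 → ℂ))) (0, p)

/-- The family `g⁻¹ φ_t g` has as velocity the pullback of the field of `h` by `g`; `hAB` says that
this pullback is the field of `h'`. -/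
theorem IsVelocity.conj {h h' : MvPolynomial (Fin 2) ℂ} (hh : IsVelocity h) (g : twoShearGroup)
    (A B : (Fin 2 → ℂ) → (Fin 2 → ℂ) →L[ℂ] (Fin 2 → ℂ))
    (hA : ∀ p, HasStrictFDerivAt (fun p : Fin 2 → ℂ => g • p) (A p) p)
    (hB : ∀ p, HasStrictFDerivAt (fun p : Fin 2 → ℂ => g⁻¹ • p) (B p) p)
    (hAB : ∀ p, B (g • p) (hamiltonianField (g • p) h) = hamiltonianField p h') :
    IsVelocity h' := by
  obtain ⟨φ, h0, hφ⟩ := hh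
  refine ⟨fun t => g⁻¹ * φ t * g, by simp [h0], fun p => ?_⟩
  have h1 : HasStrictFDerivAt (fun z : ℂ × (Fin 2 → ℂ) => (z.1, g • z.2))
      ((ContinuousLinearMap.fst ℂ ℂ (Fin 2 → ℂ)).prod
        ((A p).comp (ContinuousLinearMap.snd ℂ ℂ (Fin 2 → ℂ)))) ((0 : ℂ), p) :=
    hasStrictFDerivAt_fst.prodMk ((hA p).comp ((0 : ℂ), p) hasStrictFDerivAt_snd)
  have h2 := (hφ (g • p)).comp ((0 : ℂ), p) h1
  have h3 := HasStrictFDerivAt.comp ((0 : ℂ), p)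
    (show HasStrictFDerivAt (fun p : Fin 2 → ℂ => g⁻¹ • p) (B (g • p)) (φ 0 • g • p) by
      rw [h0, one_smul]; exact hB _) h2
  -- Chain rule for `g⁻¹ ∘ g = id`.
  have hid : (B (g • p)).comp (A p) = ContinuousLinearMap.id ℂ (Fin 2 → ℂ) := by
    refine ((hB (g • p)).comp p (hA p)).hasFDerivAt.unique ?_
    refine (hasFDerivAt_id p).congr_of_eventuallyEq (Filter.Eventually.of_forall fun x => ?_)
    simp
  refine (h3.congr_fderiv ?_).congr_of_eventuallyEq (Filter.Eventually.of_forall fun z => ?_)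
  · ext1
    · ext1
      simp [hAB]
    · ext1 v
      simpa using DFunLike.congr_fun hid v
  · simp [mul_smul]

/-- The derivative of `(X, Y + a X ^ 2)`. -/
noncomputable def shearHDeriv (a : ℂ) (p : Fin 2 → ℂ) : (Fin 2 → ℂ) →L[ℂ] (Fin 2 → ℂ) :=
  ContinuousLinearMap.pi ![ContinuousLinearMap.proj 0,
    ContinuousLinearMap.proj 1 + (2 * a * p 0) • ContinuousLinearMap.proj 0]

theorem hasStrictFDerivAt_coord (i : Fin 2) (p : Fin 2 → ℂ) :
    HasStrictFDerivAt (fun p : Fin 2 → ℂ => p i)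
      (ContinuousLinearMap.proj i : (Fin 2 → ℂ) →L[ℂ] ℂ) p :=
  (ContinuousLinearMap.proj (R := ℂ) (φ := fun _ : Fin 2 => ℂ) i).hasStrictFDerivAt

theorem hasStrictFDerivAt_shearH (a : ℂ) (p : Fin 2 → ℂ) :
    HasStrictFDerivAt (fun p : Fin 2 → ℂ => ![p 0, p 1 + a * p 0 ^ 2]) (shearHDeriv a p) p := by
  refine hasStrictFDerivAt_pi'.2 fun i => ?_
  fin_cases i
  · exact hasStrictFDerivAt_coord 0 p
  · refine ((hasStrictFDerivAt_coord 1 p).add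
      (((hasStrictFDerivAt_coord 0 p).pow 2).const_mul a)).congr_fderiv ?_
    ext v
    simp [shearHDeriv]
    ring

/-- The derivative of `(X + a Y, Y)`. -/
noncomputable def shearKDeriv (a : ℂ) : (Fin 2 → ℂ) →L[ℂ] (Fin 2 → ℂ) :=
  ContinuousLinearMap.pi ![ContinuousLinearMap.proj 0 + a • ContinuousLinearMap.proj 1,
    ContinuousLinearMap.proj 1]

theorem hasStrictFDerivAt_shearK (a : ℂ) (p : Fin 2 → ℂ) :
    HasStrictFDerivAt (fun p : Fin 2 → ℂ => ![p 0 + a * p 1 ^ 1, p 1]) (shearKDeriv a) p := by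
  convert! (shearKDeriv a).hasStrictFDerivAt using 1
  ext p i
  fin_cases i <;> simp [shearKDeriv]

open MvPolynomial

theorem IsVelocity.bind_shearK {h : MvPolynomial (Fin 2) ℂ} (hh : IsVelocity h) (a : ℂ) :
    IsVelocity (bind₁ ![X 0 + C a * X 1, X 1] h) := by
  refine hh.conj ⟨shearK 1 a, shearK_mem a⟩ (fun _ => shearKDeriv a) (fun _ => shearKDeriv (-a))
    (hasStrictFDerivAt_shearK a) (fun p => ?_) fun p => ?_
  · convert hasStrictFDerivAt_shearK (-a) p using 1
    ext q i
    fin_cases i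
    · exact (sub_eq_add_neg _ _).trans (by simp)
    · rfl
  · have hp : (⟨shearK 1 a, shearK_mem a⟩ : twoShearGroup) • p =
        fun j => eval p ((![X 0 + C a * X 1, X 1] : Fin 2 → MvPolynomial (Fin 2) ℂ) j) := by
      change ![p 0 + a * p 1 ^ 1, p 1] = _
      ext j
      fin_cases j <;> simp
    rw [hp]
    simp only [hamiltonianField_apply, pderiv_bind₁, Fin.sum_univ_two, map_add, map_mul,
      eval_bind₁]
    ext j
    fin_cases j <;> simp [shearKDeriv, pderiv_X]
    ring

theorem IsVelocity.bind_shearH {h : MvPolynomial (Fin 2) ℂ} (hh : IsVelocity h) (a : ℂ) :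
    IsVelocity (bind₁ ![X 0, X 1 + C a * X 0 ^ 2] h) := by
  refine hh.conj ⟨shearH 2 a, shearH_mem a⟩ (shearHDeriv a) (shearHDeriv (-a))
    (hasStrictFDerivAt_shearH a) (fun p => ?_) fun p => ?_
  · convert hasStrictFDerivAt_shearH (-a) p using 1
    ext q i
    fin_cases i
    · rfl
    · exact (sub_eq_add_neg _ _).trans (by simp)
  · have hp : (⟨shearH 2 a, shearH_mem a⟩ : twoShearGroup) • p =
        fun j => eval p ((![X 0, X 1 + C a * X 0 ^ 2] : Fin 2 → MvPolynomial (Fin 2) ℂ) j) := by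
      change ![p 0, p 1 + a * p 0 ^ 2] = _
      ext j
      fin_cases j <;> simp
    rw [hp]
    simp only [hamiltonianField_apply, pderiv_bind₁, Fin.sum_univ_two, map_add, map_mul,
      eval_bind₁]
    ext j
    fin_cases j <;> simp [shearHDeriv, pderiv_X]
    ring

/-- The field of `X ^ 3` is `(0, -3 X ^ 2)`, whence the parameter `-3 * t`. -/
theorem isVelocity_X_pow_three : IsVelocity (X 0 ^ 3) := by
  refine ⟨fun t => ⟨shearH 2 (-3 * t), shearH_mem _⟩, ?_, fun p => ?_⟩
  · ext p i
    fin_cases i <;> simp [shearH]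
  · have h := hasStrictFDerivAt_pi'.1 (hasStrictFDerivAt_snd (𝕜 := ℂ) (E := ℂ)
      (F := Fin 2 → ℂ) (p := ((0 : ℂ), p)))
    refine hasStrictFDerivAt_pi'.2 fun i => ?_
    fin_cases i
    · refine (h 0).congr_fderiv ?_
      ext v <;> simp [hamiltonianField_apply, pderiv_X]
    · refine ((h 1).add ((hasStrictFDerivAt_fst.const_mul (-3)).mul ((h 0).pow 2))).congr_fderiv ?_
      ext v <;> simp [hamiltonianField_apply, pderiv_X]
      ring

/-- The velocities of `⟨H_2, K_1⟩` at a tuple of distinct nonzero points span the tangent space. -/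
theorem span_isVelocity_eq_top {ι : Type*} [Fintype ι]
    (P : ι → Fin 2 → ℂ) (hinj : Function.Injective P) (h0 : ∀ i, P i ≠ 0) :
    Submodule.span ℂ ((LinearMap.pi fun i => hamiltonianField (P i)) '' {h | IsVelocity h}) =
      ⊤ := by
  rw [Submodule.span_image]
  refine map_hamiltonianField_eq_top _ (X_pow_three_mul_mem _ ?_) P hinj h0
  refine monomial_mem_of_shear_stable _ (Submodule.subset_span isVelocity_X_pow_three)
    (fun h hh t => ?_) fun h hh t => ?_
  -- Substitution is linear, so stability passes from the velocities to their span.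
  · exact (Submodule.span_le (p := (Submodule.span ℂ {h | IsVelocity h}).comap
      (bind₁ ![X 0 + C t * X 1, X 1]).toLinearMap)).2
      (fun h hh => Submodule.subset_span (IsVelocity.bind_shearK hh t)) hh
  · exact (Submodule.span_le (p := (Submodule.span ℂ {h | IsVelocity h}).comap
      (bind₁ ![X 0, X 1 + C t * X 0 ^ 2]).toLinearMap)).2
      (fun h hh => Submodule.subset_span (IsVelocity.bind_shearH hh t)) hh

/-! ### Orbits of tuples are open -/

/-- `R` is the range of the derivative at `0` of some map into the orbit of the tuple `P` that
takes the value `P` at `0`. -/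
def IsOrbitDirection {ι : Type*} [Fintype ι] (P : ι → Fin 2 → ℂ)
    (R : Submodule ℂ (ι → Fin 2 → ℂ)) : Prop :=
  ∃ (E : Type) (_ : NormedAddCommGroup E) (_ : NormedSpace ℂ E) (_ : CompleteSpace E)
    (F : E → ι → Fin 2 → ℂ) (D : E →L[ℂ] ι → Fin 2 → ℂ), F 0 = P ∧
    (∀ e, ∃ g : twoShearGroup, ∀ i, g • P i = F e i) ∧ HasStrictFDerivAt F D 0 ∧ D.range = R

theorem isOrbitDirection_bot {ι : Type*} [Fintype ι] (P : ι → Fin 2 → ℂ) :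
    IsOrbitDirection P ⊥ :=
  ⟨ℂ, inferInstance, inferInstance, inferInstance, fun _ => P, 0, rfl,
    fun _ => ⟨1, fun _ => one_smul _ _⟩, hasStrictFDerivAt_const _ _, LinearMap.range_zero⟩

/-- Following `F` by `φ t`, with `t` as a new parameter, adds the velocity of `φ` to the range. Sums
of velocities are thus reached although velocities are not known to be closed under addition. -/
theorem IsOrbitDirection.sup_span {ι : Type*} [Fintype ι] {P : ι → Fin 2 → ℂ}
    {R : Submodule ℂ (ι → Fin 2 → ℂ)} (hR : IsOrbitDirection P R) {h : MvPolynomial (Fin 2) ℂ}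
    (hh : IsVelocity h) :
    IsOrbitDirection P (R ⊔ Submodule.span ℂ {fun i => hamiltonianField (P i) h}) := by
  obtain ⟨E, _, _, _, F, D, rfl, hF, hD, rfl⟩ := hR
  obtain ⟨φ, h0, hφ⟩ := hh
  refine ⟨E × ℂ, inferInstance, inferInstance, inferInstance, fun z i => φ z.2 • F z.1 i,
    D.coprod (ContinuousLinearMap.toSpanSingleton ℂ fun i => hamiltonianField (F 0 i) h),
    by simp [h0], fun z => ?_, hasStrictFDerivAt_pi'.2 fun i => ?_, ?_⟩
  · obtain ⟨g, hg⟩ := hF z.1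
    exact ⟨φ z.2 * g, fun i => by rw [mul_smul, hg]⟩
  · have h1 : HasStrictFDerivAt (fun z : E × ℂ => F z.1)
        (D.comp (ContinuousLinearMap.fst ℂ E ℂ)) ((0 : E), (0 : ℂ)) :=
      HasStrictFDerivAt.comp ((0 : E), (0 : ℂ)) hD hasStrictFDerivAt_fst
    have h2 := (hasStrictFDerivAt_snd (𝕜 := ℂ) (p := ((0 : E), (0 : ℂ)))).prodMk
      (hasStrictFDerivAt_pi'.1 h1 i)
    refine ((hφ (F 0 i)).comp ((0 : E), (0 : ℂ)) h2).congr_fderiv ?_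
    ext <;> simp
  · ext v
    simp [Submodule.mem_sup, Submodule.mem_span_singleton]

/-- By finite dimension there is a maximal `R`; it absorbs every velocity, and these span. -/
theorem isOrbitDirection_top {ι : Type*} [Fintype ι]
    (P : ι → Fin 2 → ℂ) (hinj : Function.Injective P) (h0 : ∀ i, P i ≠ 0) :
    IsOrbitDirection P ⊤ := by
  obtain ⟨R, hR, hmax⟩ := wellFounded_gt.has_min {R | IsOrbitDirection P R}
    ⟨⊥, isOrbitDirection_bot P⟩
  convert! hR
  refine (eq_top_iff.2 ?_).symm
  rw [← span_isVelocity_eq_top P hinj h0, Submodule.span_le]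
  rintro _ ⟨h, hh, rfl⟩
  have := (le_sup_left.eq_or_lt).resolve_right (hmax _ (hR.sup_span hh))
  rw [this]
  exact Submodule.mem_sup_right (Submodule.mem_span_singleton_self _)

open Filter Topology in
/-- The orbit of a tuple of distinct nonzero points is a neighbourhood of that tuple. -/
theorem eventually_exists_smul_eq {ι : Type*} [Fintype ι]
    (P : ι → Fin 2 → ℂ) (hinj : Function.Injective P) (h0 : ∀ i, P i ≠ 0) :
    ∀ᶠ Q in 𝓝 P, ∃ g : twoShearGroup, ∀ i, g • P i = Q i := by
  obtain ⟨E, _, _, _, F, D, hFP, hF, hD, hR⟩ := isOrbitDirection_top P hinj h0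
  -- A map with surjective strict derivative is open at the point.
  rw [← hFP, ← hD.map_nhds_eq_of_surj hR]
  exact eventually_map.2 (Eventually.of_forall (hFP ▸ hF))

/-! ### Joining two tuples -/

theorem subsingleton_setOf_lineMap_eq_zero {v w : Fin 2 → ℂ} (hv : v ≠ 0) :
    {s : ℂ | AffineMap.lineMap v w s = 0}.Subsingleton := by
  intro s hs t ht
  simp only [Set.mem_ofPred_eq, AffineMap.lineMap_apply_module'] at hs ht
  have h : (s - t) • (w - v) = 0 := by
    rw [sub_smul, ← add_sub_add_right_eq_sub _ _ v, hs, ht, sub_zero]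
  rcases smul_eq_zero.1 h with h | h
  · exact sub_eq_zero.1 h
  · rw [h, smul_zero, zero_add] at hs
    exact absurd hs hv

/-- `⟨H_2, K_1⟩` is transitive on tuples of distinct nonzero points. -/
theorem exists_smul_eq_of_injective {ι : Type*} [Fintype ι] {P Q : ι → Fin 2 → ℂ}
    (hP : Function.Injective P) (hP0 : ∀ i, P i ≠ 0)
    (hQ : Function.Injective Q) (hQ0 : ∀ i, Q i ≠ 0) :
    ∃ g : twoShearGroup, ∀ i, g • P i = Q i := by
  let L : ℂ → ι → Fin 2 → ℂ := fun s => AffineMap.lineMap P Q s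
  have hL : ∀ s i, L s i = AffineMap.lineMap (P i) (Q i) s := fun s i => by
    simp [L, AffineMap.lineMap_apply_module]
  have hsub : ∀ s i j, L s i - L s j = AffineMap.lineMap (P i - P j) (Q i - Q j) s :=
    fun s i j => by
      rw [hL, hL]
      simp only [AffineMap.lineMap_apply_module]
      module
  -- On the complex line through `P` and `Q`, `B` collects the parameters where a point hits the
  -- origin or two points collide. Removing a countable set from `ℂ`, of real dimension 2, leaves it
  -- connected.
  let B : Set ℂ := (⋃ i, {s | L s i = 0}) ∪ ⋃ i, ⋃ j, ⋃ _ : i ≠ j, {s | L s i - L s j = 0}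
  have hB : B.Countable := by
    refine (Set.countable_iUnion fun i => ?_).union (Set.countable_iUnion fun i =>
      Set.countable_iUnion fun j => Set.countable_iUnion fun hij => ?_)
    · simp only [hL]
      exact (subsingleton_setOf_lineMap_eq_zero (hP0 i)).countable
    · simp only [hsub]
      exact (subsingleton_setOf_lineMap_eq_zero (sub_ne_zero.2 (hP.ne hij))).countable
  have hgood : ∀ s, s ∈ Bᶜ ↔ Function.Injective (L s) ∧ ∀ i, L s i ≠ 0 := by
    intro s
    simp only [B, Set.mem_compl_iff, Set.mem_union, Set.mem_iUnion, Set.mem_ofPred_eq, not_or,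
      not_exists, sub_eq_zero]
    rw [and_comm]
    refine and_congr_left fun _ => ⟨fun h i j hij => ?_, fun h i j hij h' => hij (h h')⟩
    by_contra hne
    exact h i j hne hij
  have hconn := (hB.isConnected_compl_of_one_lt_rank (by simp)).isPreconnected
  have hL0 : L 0 = P := AffineMap.lineMap_apply_zero _ _
  have hL1 : L 1 = Q := AffineMap.lineMap_apply_one _ _
  have key := hconn.induction₂' (fun s t => ∃ g : twoShearGroup, ∀ i, g • L s i = L t i)
    (fun s hs => ?_) (fun s t u _ _ _ ⟨g, hg⟩ ⟨g', hg'⟩ => ⟨g' * g, fun i => by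
      rw [mul_smul, hg, hg']⟩)
    ((hgood 0).2 (by rw [hL0]; exact ⟨hP, hP0⟩)) ((hgood 1).2 (by rw [hL1]; exact ⟨hQ, hQ0⟩))
  · rwa [hL0, hL1] at key
  · have hcont : Continuous L := AffineMap.lineMap_continuous
    have := hcont.continuousAt.eventually
      (eventually_exists_smul_eq (L s) ((hgood s).1 hs).1 ((hgood s).1 hs).2)
    filter_upwards [mem_nhdsWithin_of_mem_nhds this] with t ⟨g, hg⟩
    exact ⟨⟨g, hg⟩, g⁻¹, fun i => by rw [← hg, inv_smul_smul]⟩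

/-! ### The two orbits and the Zariski topology -/

theorem smul_zero_of_mem (g : twoShearGroup) : g • (0 : Fin 2 → ℂ) = 0 := by
  have h : twoShearGroup ≤ MulAction.stabilizer PlaneAut (0 : Fin 2 → ℂ) := by
    refine sup_le ?_ ?_
    · rintro _ ⟨a, rfl⟩
      show ![(0 : ℂ), 0 + a * 0 ^ 2] = 0
      ext i
      fin_cases i <;> simp
    · rintro _ ⟨a, rfl⟩
      show ![(0 : ℂ) + a * 0 ^ 1, 0] = 0
      ext i
      fin_cases i <;> simp
  exact h g.2

theorem orbit_eq_compl_zero {p : Fin 2 → ℂ} (hp : p ≠ 0) :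
    MulAction.orbit twoShearGroup p = {0}ᶜ := by
  ext q
  constructor
  · rintro ⟨g, rfl⟩ h
    refine hp (smul_left_cancel g ?_)
    rw [smul_zero_of_mem]
    exact h
  · intro hq
    obtain ⟨g, hg⟩ := exists_smul_eq_of_injective (P := fun _ : Unit => p) (Q := fun _ => q)
      (Function.injective_of_subsingleton _) (fun _ => hp)
      (Function.injective_of_subsingleton _) (fun _ => hq)
    exact ⟨g, hg ()⟩

theorem orbit_zero : MulAction.orbit twoShearGroup (0 : Fin 2 → ℂ) = {0} :=
  Set.eq_singleton_iff_unique_mem.2 ⟨MulAction.mem_orbit_self _, by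
    rintro _ ⟨g, rfl⟩
    exact smul_zero_of_mem g⟩

theorem isZariskiOpen_compl_zero : IsZariskiOpen {(0 : Fin 2 → ℂ)}ᶜ := by
  refine ⟨Ideal.span (Set.range X), congrArg compl ?_⟩
  rw [zeroLocus_span]
  ext p
  simp only [Set.mem_singleton_iff, Set.mem_ofPred_eq, Set.forall_mem_range, aeval_X, funext_iff,
    Pi.zero_apply]

theorem not_isZariskiOpen_zero : ¬ IsZariskiOpen {(0 : Fin 2 → ℂ)} := by
  rintro ⟨I, hI⟩
  have hmem : ∀ p : Fin 2 → ℂ, p ≠ 0 → ∀ f ∈ I, aeval p f = 0 := fun p hp => by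
    by_contra h
    exact hp (hI.symm ▸ h : p ∈ ({0} : Set (Fin 2 → ℂ)))
  have h0 : (0 : Fin 2 → ℂ) ∈ (zeroLocus ℂ I)ᶜ := hI ▸ rfl
  refine h0 fun f hf => ?_
  -- `f` vanishes off the origin and `X` at it, so the product vanishes everywhere and `f = 0`.
  have hXf : X 0 * f = 0 := MvPolynomial.funext fun p => by
    by_cases hp : p = 0
    · simp [hp]
    · have := hmem p hp f hf
      rw [aeval_eq_eval] at this
      simp [this]
  rw [(mul_eq_zero.1 hXf).resolve_left (X_ne_zero 0), map_zero]

theorem mainTheorem9 :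
    ∃ p : Fin 2 → ℂ,
      IsZariskiOpen (MulAction.orbit (rootH 2 ⊔ rootK 1 : Subgroup PlaneAut) p) ∧
      (∀ q : Fin 2 → ℂ,
        IsZariskiOpen (MulAction.orbit (rootH 2 ⊔ rootK 1 : Subgroup PlaneAut) q) →
          MulAction.orbit (rootH 2 ⊔ rootK 1 : Subgroup PlaneAut) q =
            MulAction.orbit (rootH 2 ⊔ rootK 1 : Subgroup PlaneAut) p) ∧
      IsInfinitelyTransitive (rootH 2 ⊔ rootK 1 : Subgroup PlaneAut)
        (MulAction.orbit (rootH 2 ⊔ rootK 1 : Subgroup PlaneAut) p) := by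
  have hp : (fun _ => 1 : Fin 2 → ℂ) ≠ 0 := fun h => one_ne_zero (congrFun h 0)
  refine ⟨fun _ => 1, ?_, fun q hq => ?_, fun m => ?_⟩
  · rw [orbit_eq_compl_zero hp]
    exact isZariskiOpen_compl_zero
  · rw [orbit_eq_compl_zero hp]
    refine orbit_eq_compl_zero ?_
    rintro rfl
    refine not_isZariskiOpen_zero ?_
    rwa [orbit_zero] at hq
  · have hne : ∀ x : MulAction.orbit twoShearGroup (fun _ => 1 : Fin 2 → ℂ), x.1 ≠ 0 := fun x => by
      exact (orbit_eq_compl_zero hp).subset x.2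
    refine MulAction.isMultiplyPretransitive_iff.2 fun x y => ?_
    obtain ⟨g, hg⟩ := exists_smul_eq_of_injective (Subtype.val_injective.comp x.injective)
      (fun i => hne (x i)) (Subtype.val_injective.comp y.injective) (fun i => hne (y i))
    exact ⟨g, Function.Embedding.ext fun i => Subtype.ext (hg i)⟩
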